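/- Let $D$ be an integral domain with quotient field $K$, and let $\star$ be a semistar operation on $D$, i.e. a map $E\mapsto E^\star$ from the set of nonzero $D$-submodules of $K$ to itself such that, for all nonzero $D$-submodules $E,F$ of $K$ and all nonzero $x\in K$: $(xE)^\star=xE^\star$; $E\subseteq F$ implies $E^\star\subseteq F^\star$; $E\subseteq E^\star$ and $(E^\star)^\star=E^\star$. Let $\star_f$ be the associated finite-type semistar operation, $E^{\star_f}=\bigcup\{F^\star : F\subseteq E \text{ a nonzero finitely generated } D\text{-submodule of } K\}$. A quasi-$\star_f$-prime of $D$ is a nonzero prime ideal $P$ of $D$ with $P=P^{\star_f}\cap D$, and $P$ is $\star_f$-idempotent if $P^{\star_f}=(P^2)^{\star_f}$. A prime ideal $P$ of a ring is branched if there is a $P$-primary ideal distinct from $P$. The domain $D$ is a P$\star$MD if $(FF^{-1})^{\star_f}=D^{\star_f}$ for every nonzero finitely generated $D$-submodule $F$ of $K$, where $F^{-1}=\{u\in K : uF\subseteq D\}$. A P$\star$MD is $\star_f$-discrete (respectively $\star_f$-strongly discrete) if it has no branched $\star_f$-idempotent quasi-$\star_f$-prime ideals (respectively no $\star_f$-idempotent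 quasi-$\star_f$-prime ideals). A Prüfer domain (an integral domain, possibly a field, in which every nonzero finitely generated ideal is invertible) is discrete (respectively strongly discrete) if it has no nonzero branched idempotent prime ideals (respectively no nonzero idempotent prime ideals). Let $\mathrm{Na}(D,\star)=D[X]_{N(\star)}$ be the semistar Nagata ring, where $N(\star)=\{g\in D[X] : g\neq 0,\ c(g)^\star=D^\star\}$ and $c(g)$ is the ideal of $D$ generated by the coefficients of $g$. Then: (1) $D$ is a $\star_f$-discrete P$\star$MD if and only if $\mathrm{Na}(D,\star)$ is a discrete Prüfer domain; (2) $D$ is a $\star_f$-strongly discrete P$\star$MD if and only if $\mathrm{Na}(D,\star)$ is a strongly discrete Prüfer domain. -/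

import Mathlib

open scoped Pointwise Polynomial nonZeroDivisors

/-- A semistar operation on the domain `D` with quotient field `K`: a map `E ↦ E^⋆` on the nonzero
`D`-submodules of `K`, satisfying the three usual axioms. The map is extended to all submodules by
`0^⋆ = 0`, which determines the extension uniquely and loses nothing, since the axioms then hold
for the zero submodule as well. -/
structure SemistarOperation (D K : Type*) [CommRing D] [Field K] [Algebra D K] where
  star : Submodule D K → Submodule D K
  star_bot : star ⊥ = ⊥
  star_smul : ∀ (x : K), x ≠ 0 → ∀ E : Submodule D K, star (x • E) = x • star E
  star_mono : ∀ E F : Submodule D K, E ≤ F → star E ≤ star F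
  le_star : ∀ E : Submodule D K, E ≤ star E
  star_star : ∀ E : Submodule D K, star (star E) = star E

namespace SemistarOperation

variable {D K : Type*} [CommRing D] [Field K] [Algebra D K] (s : SemistarOperation D K)

theorem star_mul_star_le (E F : Submodule D K) : s.star E * s.star F ≤ s.star (E * F) := by
  have key : ∀ A B : Submodule D K, A * s.star B ≤ s.star (A * B) := by
    intro A B
    rw [Submodule.mul_le]
    intro x hx y hy
    by_cases h0 : x = 0
    · simp [h0]
    · have h1 : x • B ≤ A * B := by
        intro z hz
        obtain ⟨b, hb, rfl⟩ := (Submodule.mem_smul_pointwise_iff_exists _ _ _).1 hz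
        exact Submodule.mul_mem_mul hx hb
      have h2 := s.star_mono _ _ h1
      rw [s.star_smul x h0] at h2
      exact h2 (Submodule.smul_mem_pointwise_smul y x _ hy)
  calc s.star E * s.star F ≤ s.star (s.star E * F) := key _ _
    _ = s.star (F * s.star E) := by rw [mul_comm]
    _ ≤ s.star (s.star (F * E)) := s.star_mono _ _ (key _ _)
    _ = s.star (E * F) := by rw [s.star_star, mul_comm]

/-- The underlying map of `⋆_f`: the submodule `E^{⋆_f}` is the union of all `F^⋆`, where `F` runs
over the finitely generated submodules of `E`. -/
def finiteTypeStar (E : Submodule D K) : Submodule D K where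
  carrier := {x | ∃ F : Submodule D K, F.FG ∧ F ≤ E ∧ x ∈ s.star F}
  zero_mem' := ⟨⊥, Submodule.fg_bot, bot_le, Submodule.zero_mem _⟩
  add_mem' := by
    rintro a b ⟨F, hF, hFE, ha⟩ ⟨G, hG, hGE, hb⟩
    exact ⟨F ⊔ G, hF.sup hG, sup_le hFE hGE,
      Submodule.add_mem _ (s.star_mono _ _ le_sup_left ha) (s.star_mono _ _ le_sup_right hb)⟩
  smul_mem' := by
    rintro c a ⟨F, hF, hFE, ha⟩
    exact ⟨F, hF, hFE, Submodule.smul_mem _ c ha⟩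

theorem mem_finiteTypeStar {E : Submodule D K} {x : K} :
    x ∈ s.finiteTypeStar E ↔ ∃ F : Submodule D K, F.FG ∧ F ≤ E ∧ x ∈ s.star F := Iff.rfl

theorem le_finiteTypeStar (E : Submodule D K) : E ≤ s.finiteTypeStar E := by
  intro x hx
  exact ⟨Submodule.span D {x}, Submodule.fg_span_singleton x,
    by rwa [Submodule.span_singleton_le_iff_mem], s.le_star _ (Submodule.mem_span_singleton_self x)⟩

theorem finiteTypeStar_mono {E F : Submodule D K} (h : E ≤ F) :
    s.finiteTypeStar E ≤ s.finiteTypeStar F := by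
  rintro x ⟨G, hG, hGE, hx⟩
  exact ⟨G, hG, hGE.trans h, hx⟩

/-- A finitely generated submodule of `E^{⋆_f}` lies in `G^⋆` for a single finitely generated
submodule `G` of `E`. -/
theorem exists_fg_of_le_finiteTypeStar {E F : Submodule D K} (hF : F.FG)
    (h : F ≤ s.finiteTypeStar E) : ∃ G : Submodule D K, G.FG ∧ G ≤ E ∧ F ≤ s.star G := by
  induction F, hF using Submodule.fg_induction with
  | singleton x =>
    obtain ⟨G, hG, hGE, hx⟩ := h (Submodule.mem_span_singleton_self x)
    exact ⟨G, hG, hGE, by rwa [Submodule.span_singleton_le_iff_mem]⟩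
  | sup A B hA hB ihA ihB =>
    obtain ⟨G, hG, hGE, hx⟩ := ihA (le_sup_left.trans h)
    obtain ⟨H, hH, hHE, hy⟩ := ihB (le_sup_right.trans h)
    exact ⟨G ⊔ H, hG.sup hH, sup_le hGE hHE,
      sup_le (hx.trans (s.star_mono _ _ le_sup_left)) (hy.trans (s.star_mono _ _ le_sup_right))⟩

theorem smul_finiteTypeStar_le (x : K) (hx : x ≠ 0) (E : Submodule D K) :
    x • s.finiteTypeStar E ≤ s.finiteTypeStar (x • E) := by
  intro y hy
  obtain ⟨z, ⟨F, hF, hFE, hz⟩, rfl⟩ := (Submodule.mem_smul_pointwise_iff_exists _ _ _).1 hy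
  refine ⟨x • F, hF.map _, Submodule.map_mono hFE, ?_⟩
  rw [s.star_smul x hx]
  exact Submodule.smul_mem_pointwise_smul z x _ hz

/-- The finite-type semistar operation `⋆_f` associated with `⋆`. -/
def finiteType : SemistarOperation D K where
  star := s.finiteTypeStar
  star_bot := by
    rw [eq_bot_iff]
    rintro x ⟨F, -, hF, hx⟩
    rw [le_bot_iff] at hF
    rwa [hF, s.star_bot] at hx
  star_smul := by
    intro x hx E
    refine le_antisymm ?_ (s.smul_finiteTypeStar_le x hx E)
    have h := s.smul_finiteTypeStar_le x⁻¹ (inv_ne_zero hx) (x • E)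
    rw [smul_smul, inv_mul_cancel₀ hx, one_smul] at h
    intro y hy
    rw [Submodule.mem_smul_pointwise_iff_exists]
    refine ⟨x⁻¹ • y, h (Submodule.smul_mem_pointwise_smul y x⁻¹ _ hy), ?_⟩
    rw [smul_smul, mul_inv_cancel₀ hx, one_smul]
  star_mono := fun _ _ h => s.finiteTypeStar_mono h
  le_star := s.le_finiteTypeStar
  star_star := by
    intro E
    refine le_antisymm ?_ (s.le_finiteTypeStar _)
    rintro x ⟨F, hF, hFE, hx⟩
    obtain ⟨G, hG, hGE, hFG⟩ := s.exists_fg_of_le_finiteTypeStar hF hFE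
    refine ⟨G, hG, hGE, ?_⟩
    have := s.star_mono _ _ hFG hx
    rwa [s.star_star] at this

/-- `E` is `⋆`-idempotent if `E^⋆ = (E²)^⋆`. -/
def IsStarIdempotent (E : Submodule D K) : Prop := s.star E = s.star (E ^ 2)

/-- A nonzero ideal `I` of `D` is a quasi-`⋆`-ideal if `I = I^⋆ ∩ D`. Here
`IsLocalization.coeSubmodule K I` is `I` regarded as a `D`-submodule of `K`. -/
def IsQuasiStarIdeal (I : Ideal D) : Prop :=
  I ≠ ⊥ ∧ I = (s.star (IsLocalization.coeSubmodule K I)).comap (Algebra.linearMap D K)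

/-- A quasi-`⋆`-prime is a prime quasi-`⋆`-ideal. -/
def IsQuasiStarPrime (P : Ideal D) : Prop := s.IsQuasiStarIdeal P ∧ P.IsPrime

/-- `D` is a Prüfer `⋆`-multiplication domain if `(F F⁻¹)^{⋆_f} = D^{⋆_f}` for all nonzero finitely
generated `D`-submodules `F` of `K`. Here `1` is `D` as a submodule of `K`, and `1 / F` is
`F⁻¹ = (D : F) = {u ∈ K | u F ⊆ D}`. -/
def IsPStarMD : Prop :=
  ∀ F : Submodule D K, F ≠ ⊥ → F.FG → s.finiteType.star (F * (1 / F)) = s.finiteType.star 1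

/-- The multiplicatively closed set `N(⋆) = {g ∈ D[X] | c(g)^⋆ = D^⋆}`. -/
def nagataSubmonoid : Submonoid D[X] where
  carrier := {g | s.star (IsLocalization.coeSubmodule K g.contentIdeal) = s.star 1}
  one_mem' := by
    simp [Polynomial.contentIdeal_one, IsLocalization.coeSubmodule_top]
  mul_mem' := by
    intro f g hf hg
    simp only [Set.mem_ofPred_eq] at hf hg ⊢
    have hle : ∀ I : Ideal D, IsLocalization.coeSubmodule K I ≤ 1 := fun I => by
      rw [← IsLocalization.coeSubmodule_top]
      exact IsLocalization.coeSubmodule_mono K le_top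
    have hmul : ∀ I J : Ideal D,
        s.star 1 ≤ s.star (IsLocalization.coeSubmodule K I) →
        s.star 1 ≤ s.star (IsLocalization.coeSubmodule K J) →
        s.star 1 ≤ s.star (IsLocalization.coeSubmodule K (I * J)) := by
      intro I J hI hJ
      have h1 : (1 : Submodule D K) ≤ s.star (IsLocalization.coeSubmodule K (I * J)) := by
        calc (1 : Submodule D K) = 1 * 1 := (one_mul 1).symm
          _ ≤ s.star (IsLocalization.coeSubmodule K I) * s.star (IsLocalization.coeSubmodule K J) :=
            mul_le_mul' ((s.le_star 1).trans hI) ((s.le_star 1).trans hJ)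
          _ ≤ _ := s.star_mul_star_le _ _
          _ = _ := by rw [IsLocalization.coeSubmodule_mul]
      have h2 := s.star_mono _ _ h1
      rwa [s.star_star] at h2
    have hpow : ∀ (I : Ideal D) (n : ℕ), s.star 1 ≤ s.star (IsLocalization.coeSubmodule K I) →
        s.star 1 ≤ s.star (IsLocalization.coeSubmodule K (I ^ n)) := by
      intro I n hI
      induction n with
      | zero => rw [pow_zero, Ideal.one_eq_top, IsLocalization.coeSubmodule_top]
      | succ n ih => rw [pow_succ]; exact hmul _ _ ih hI
    obtain ⟨n, hn⟩ := Ideal.exists_pow_le_of_le_radical_of_fg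
      (Polynomial.mul_contentIdeal_le_radical_contentIdeal_mul (p := f) (q := g))
      (f.contentIdeal_FG.mul g.contentIdeal_FG)
    refine le_antisymm (s.star_mono _ _ (hle _)) ?_
    exact (hpow _ n (hmul _ _ hf.ge hg.ge)).trans
      (s.star_mono _ _ (IsLocalization.coeSubmodule_mono K hn))

/-- The semistar Nagata ring `Na(D,⋆) = D[X]_{N(⋆)}`. -/
abbrev Nagata : Type _ := Localization s.nagataSubmonoid

end SemistarOperation

/-- A prime ideal `P` is branched if there is a `P`-primary ideal distinct from `P`. -/
def IsBranched {R : Type*} [CommRing R] (P : Ideal R) : Prop :=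
  ∃ Q : Ideal R, Q.IsPrimary ∧ Q.radical = P ∧ Q ≠ P

/-- A Prüfer domain: an integral domain in which every nonzero finitely generated ideal is
invertible. (In particular, fields are Prüfer domains.) -/
structure IsPruferDomain (R : Type*) [CommRing R] : Prop where
  isDomain : IsDomain R
  isUnit_of_fg : ∀ I : Ideal R, I ≠ ⊥ → I.FG → IsUnit (I : FractionalIdeal R⁰ (FractionRing R))

/-- A Prüfer domain is strongly discrete if it has no nonzero idempotent prime ideals. -/
structure IsStronglyDiscretePruferDomain (R : Type*) [CommRing R] : Prop
    extends IsPruferDomain R where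
  not_idempotent : ∀ P : Ideal R, P ≠ ⊥ → P.IsPrime → ¬ IsIdempotentElem P

/-- A Prüfer domain is discrete if it has no nonzero branched idempotent prime ideals. -/
structure IsDiscretePruferDomain (R : Type*) [CommRing R] : Prop
    extends IsPruferDomain R where
  not_idempotent : ∀ P : Ideal R, P ≠ ⊥ → P.IsPrime → IsBranched P → ¬ IsIdempotentElem P

namespace SemistarOperation

variable {D K : Type*} [CommRing D] [Field K] [Algebra D K] (s : SemistarOperation D K)

/-- A P⋆MD is `⋆_f`-strongly discrete if it has no `⋆_f`-idempotent quasi-`⋆_f`-primes. -/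
structure IsStronglyDiscretePStarMD : Prop where
  isPStarMD : s.IsPStarMD
  not_idempotent : ∀ P : Ideal D, s.finiteType.IsQuasiStarPrime P →
    ¬ s.finiteType.IsStarIdempotent (IsLocalization.coeSubmodule K P)

/-- A P⋆MD is `⋆_f`-discrete if it has no branched `⋆_f`-idempotent quasi-`⋆_f`-primes. -/
structure IsDiscretePStarMD : Prop where
  isPStarMD : s.IsPStarMD
  not_idempotent : ∀ P : Ideal D, s.finiteType.IsQuasiStarPrime P → IsBranched P →
    ¬ s.finiteType.IsStarIdempotent (IsLocalization.coeSubmodule K P)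

end SemistarOperation

/-! Extension and contraction along `D → Na(D,⋆)` match the two sides. The key fact over a P⋆MD is
that `h` divides `f` in the Nagata ring as soon as `c(f) ⊆ c(h)` (`IsPStarMD.algebraMap_dvd`). It
makes the ring Bézout, hence Prüfer, and makes every ideal the extension of its contraction
(`IsPStarMD.map_comap_toNagata`). Conversely, if the Nagata ring is Prüfer, a relation `F J = (a)`
there descends to `D` by clearing denominators and gives the P⋆MD property. Moreover `I^{⋆_f}` and
the extension of `I` have the same trace on `D` (`IsPStarMD.mem_finiteType_iff`). So
quasi-`⋆_f`-primes correspond to nonzero primes and `⋆_f`-idempotence to idempotence. Branchedness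
passes both ways; going up requires a localization. -/

namespace Polynomial

/-! ### Content ideals of polynomials. -/

theorem contentIdeal_le_iff_mem_map_C {R : Type*} [CommRing R] {f : R[X]} {I : Ideal R} :
    f.contentIdeal ≤ I ↔ f ∈ I.map (C : R →+* R[X]) := by
  rw [Ideal.mem_map_C_iff, contentIdeal_def, Ideal.span_le]
  refine ⟨fun h n => ?_, fun h x hx => ?_⟩
  · by_cases h0 : f.coeff n = 0
    · rw [h0]; exact I.zero_mem
    · exact h (coeff_mem_coeffs h0)
  · obtain ⟨n, -, rfl⟩ := mem_coeffs_iff.1 hx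
    exact h n

/-- Shifting one of two polynomials past the degree of the other makes the content ideal of their
sum the sum of their content ideals. -/
theorem contentIdeal_add_X_pow_mul {R : Type*} [CommRing R] {f : R[X]} (g : R[X]) {N : ℕ}
    (hN : f.natDegree < N) :
    (f + X ^ N * g).contentIdeal = f.contentIdeal ⊔ g.contentIdeal := by
  have hlow : ∀ n < N, (f + X ^ N * g).coeff n = f.coeff n := fun n hn => by
    rw [coeff_add, coeff_X_pow_mul', if_neg (by omega), add_zero]
  have hhigh : ∀ n, (f + X ^ N * g).coeff (n + N) = g.coeff n := fun n => by
    rw [coeff_add, coeff_X_pow_mul, coeff_eq_zero_of_natDegree_lt (by omega), zero_add]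
  refine le_antisymm ?_ (sup_le ?_ ?_) <;> rw [contentIdeal_le_iff_mem_map_C, Ideal.mem_map_C_iff]
  · intro n
    rcases lt_or_ge n N with hn | hn
    · rw [hlow n hn]
      exact Ideal.mem_sup_left (f.coeff_mem_contentIdeal n)
    · obtain ⟨m, rfl⟩ := Nat.exists_eq_add_of_le' hn
      rw [hhigh]
      exact Ideal.mem_sup_right (g.coeff_mem_contentIdeal m)
  · intro n
    rcases lt_or_ge n N with hn | hn
    · rw [← hlow n hn]
      exact coeff_mem_contentIdeal _ n
    · rw [coeff_eq_zero_of_natDegree_lt (by omega)]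
      exact Ideal.zero_mem _
  · intro n
    rw [← hhigh]
    exact coeff_mem_contentIdeal _ _

/-- For every finitely generated ideal `J` there is a polynomial with coefficients in `J` whose
product with `f` has content ideal `c(f) J`. -/
theorem exists_contentIdeal_mul_eq {R : Type*} [CommRing R] (f : R[X]) {J : Ideal R} (hJ : J.FG) :
    ∃ k : R[X], k ∈ J.map (C : R →+* R[X]) ∧ (f * k).contentIdeal = f.contentIdeal * J := by
  induction J, hJ using Submodule.fg_induction with
  | singleton x =>
    refine ⟨C x, Ideal.mem_map_of_mem _ (Submodule.mem_span_singleton_self x), ?_⟩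
    refine le_antisymm ((contentIdeal_mul_le_mul_contentIdeal _ _).trans ?_) ?_
    · rw [contentIdeal_C]
    · rw [contentIdeal_def f]
      change Ideal.span _ * Ideal.span {x} ≤ _
      rw [Ideal.span_mul_span', Ideal.span_le]
      rintro _ ⟨a, ha, y, rfl, rfl⟩
      obtain ⟨n, -, rfl⟩ := mem_coeffs_iff.1 ha
      simpa using coeff_mem_contentIdeal (f * C y) n
  | sup A B hA hB ihA ihB =>
    obtain ⟨k, hk, hfk⟩ := ihA
    obtain ⟨l, hl, hfl⟩ := ihB
    -- The shift exceeds the degree of `f * k`, so the coefficients of `f * k` and `f * l` do not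
    -- overlap and the two contents add.
    refine ⟨k + X ^ ((f * k).natDegree + 1) * l, Ideal.add_mem _
      (Ideal.map_mono le_sup_left hk)
      (Ideal.mul_mem_left _ _ (Ideal.map_mono le_sup_right hl)), ?_⟩
    rw [mul_add, mul_left_comm, contentIdeal_add_X_pow_mul _ (Nat.lt_succ_self _), hfk, hfl]
    exact (Ideal.mul_sup _ _ _).symm

theorem exists_contentIdeal_eq {R : Type*} [CommRing R] {J : Ideal R} (hJ : J.FG) :
    ∃ k : R[X], k.contentIdeal = J := by
  obtain ⟨k, -, hk⟩ := exists_contentIdeal_mul_eq 1 hJ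
  exact ⟨k, by simpa using hk⟩

end Polynomial

/-! ### Star closures, `N(⋆)` and the P⋆MD property inside `D[X]`. -/

namespace SemistarOperation

open Polynomial IsLocalization

variable {D K : Type*} [CommRing D] [Field K] [Algebra D K] (s : SemistarOperation D K)

theorem star_le_iff {E F : Submodule D K} : s.star E ≤ s.star F ↔ E ≤ s.star F := by
  refine ⟨(s.le_star E).trans, fun h => ?_⟩
  have := s.star_mono _ _ h
  rwa [s.star_star] at this

theorem coeSubmodule_le_one (I : Ideal D) : coeSubmodule K I ≤ 1 := by
  rw [← coeSubmodule_top]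
  exact coeSubmodule_mono K le_top

theorem star_eq_star_one_iff {E : Submodule D K} (hE : E ≤ 1) :
    s.star E = s.star 1 ↔ (1 : K) ∈ s.star E := by
  rw [← Submodule.one_le, ← s.star_le_iff]
  exact ⟨fun h => h.ge, fun h => le_antisymm (s.star_mono _ _ hE) h⟩

theorem mem_nagataSubmonoid {g : D[X]} :
    g ∈ s.nagataSubmonoid ↔ (1 : K) ∈ s.star (coeSubmodule K g.contentIdeal) :=
  s.star_eq_star_one_iff (coeSubmodule_le_one _)

theorem algebraMap_mem_coeSubmodule (I : Ideal D) {x : D} (hx : x ∈ I) :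
    algebraMap D K x ∈ coeSubmodule K I := ⟨x, hx, rfl⟩

theorem coeSubmodule_comap {E : Submodule D K} (hE : E ≤ 1) :
    coeSubmodule K (E.comap (Algebra.linearMap D K) : Ideal D) = E := by
  rw [coeSubmodule, Submodule.map_comap_eq, ← Submodule.one_eq_range]
  exact inf_eq_right.2 hE

theorem ne_zero_of_mem_nagataSubmonoid {g : D[X]} (hg : g ∈ s.nagataSubmonoid) : g ≠ 0 := by
  rintro rfl
  have := s.mem_nagataSubmonoid.1 hg
  simp [s.star_bot] at this

theorem mul_mem_smul {x y : K} {E : Submodule D K} (hy : y ∈ E) : x * y ∈ x • E :=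
  Submodule.smul_mem_pointwise_smul y x E hy

theorem smul_le_iff {x : K} {E F : Submodule D K} : x • E ≤ F ↔ ∀ y ∈ E, x * y ∈ F := by
  refine ⟨fun h y hy => h (mul_mem_smul hy), fun h z hz => ?_⟩
  obtain ⟨y, hy, rfl⟩ := (Submodule.mem_smul_pointwise_iff_exists _ _ _).1 hz
  exact h y hy

theorem nagataSubmonoid_le_nonZeroDivisors [IsDomain D] : s.nagataSubmonoid ≤ D[X]⁰ :=
  fun _ hg => mem_nonZeroDivisors_of_ne_zero (s.ne_zero_of_mem_nagataSubmonoid hg)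

theorem mem_star_smul_iff {x : K} (hx : x ≠ 0) {E : Submodule D K} :
    x ∈ s.star (x • E) ↔ (1 : K) ∈ s.star E := by
  rw [s.star_smul x hx]
  constructor
  · intro h
    obtain ⟨y, hy, h⟩ := (Submodule.mem_smul_pointwise_iff_exists _ _ _).1 h
    have : y = 1 := mul_left_cancel₀ hx (by simpa using h)
    rwa [← this]
  · intro h
    simpa using mul_mem_smul (x := x) h

variable [IsFractionRing D K]

theorem algebraMap_mem_coeSubmodule_iff {I : Ideal D} {x : D} :
    algebraMap D K x ∈ coeSubmodule K I ↔ x ∈ I := by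
  refine ⟨?_, algebraMap_mem_coeSubmodule I⟩
  rintro ⟨y, hy, h⟩
  rwa [← IsFractionRing.injective D K h]

theorem mem_finiteType_coeSubmodule {I : Ideal D} {x : K} :
    x ∈ s.finiteType.star (coeSubmodule K I) ↔
      ∃ J : Ideal D, J.FG ∧ J ≤ I ∧ x ∈ s.star (coeSubmodule K J) := by
  constructor
  · rintro ⟨F, hF, hFI, hx⟩
    have h := coeSubmodule_comap (hFI.trans (coeSubmodule_le_one I))
    refine ⟨F.comap (Algebra.linearMap D K), ?_, ?_, by rwa [h]⟩
    · refine (coeSubmodule_fg K (IsFractionRing.injective D K) _).1 ?_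
      rwa [h]
    · intro y hy
      exact algebraMap_mem_coeSubmodule_iff.1 (hFI hy)
  · rintro ⟨J, hJ, hJI, hx⟩
    exact ⟨_, Submodule.FG.map _ hJ, coeSubmodule_mono K hJI, hx⟩

/-- The bridge from `⋆_f` to polynomials: a finitely generated ideal is the content of some
polynomial, which lies in `N(⋆)` exactly when the closure of that ideal contains `1`. -/
theorem one_mem_finiteType_coeSubmodule {I : Ideal D} :
    (1 : K) ∈ s.finiteType.star (coeSubmodule K I) ↔
      ∃ g ∈ s.nagataSubmonoid, g ∈ I.map (C : D →+* D[X]) := by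
  rw [mem_finiteType_coeSubmodule]
  constructor
  · rintro ⟨J, hJ, hJI, h⟩
    obtain ⟨g, rfl⟩ := exists_contentIdeal_eq hJ
    exact ⟨g, s.mem_nagataSubmonoid.2 h, contentIdeal_le_iff_mem_map_C.1 hJI⟩
  · rintro ⟨g, hg, hgI⟩
    exact ⟨_, g.contentIdeal_FG, contentIdeal_le_iff_mem_map_C.2 hgI, s.mem_nagataSubmonoid.1 hg⟩

/-- In a P⋆MD, membership in `I^{⋆_f}` is witnessed by an element of `N(⋆)`. -/
theorem IsPStarMD.exists_C_mul_mem (hs : s.IsPStarMD) {I : Ideal D} {x : D}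
    (hx : algebraMap D K x ∈ s.finiteType.star (coeSubmodule K I)) :
    ∃ g ∈ s.nagataSubmonoid, C x * g ∈ I.map (C : D →+* D[X]) := by
  by_cases hx0 : x = 0
  · exact ⟨1, one_mem _, by simp [hx0]⟩
  have hx' : algebraMap D K x ≠ 0 := by simpa using hx0
  obtain ⟨F, hF, hFI, hxF⟩ := hx
  set t := s.finiteType
  -- Adjoining `x ∈ F^⋆` to `F` does not change the closure, so `⋆_f`-invertibility of `G` already
  -- gives `1 ∈ (F G⁻¹)^{⋆_f}`, while `x F G⁻¹ ⊆ F`.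
  set G := F ⊔ Submodule.span D {algebraMap D K x}
  have hxG : algebraMap D K x ∈ G :=
    Submodule.mem_sup_right (Submodule.mem_span_singleton_self _)
  have hG0 : G ≠ ⊥ := fun h => hx' (by simpa [h] using hxG)
  have hGF : G ≤ t.star F := sup_le (t.le_star F) (by
    rw [Submodule.span_singleton_le_iff_mem]
    exact ⟨F, hF, le_rfl, hxF⟩)
  have hW : F * (1 / G) ≤ 1 := (mul_le_mul' le_sup_left le_rfl).trans Submodule.mul_one_div_le_one
  have h1 : (1 : K) ∈ t.star (F * (1 / G)) := by
    rw [← Submodule.one_le, ← t.star_le_iff,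
      ← hs G hG0 (hF.sup (Submodule.fg_span_singleton _)), t.star_le_iff]
    exact (mul_le_mul' hGF (t.le_star _)).trans (t.star_mul_star_le _ _)
  rw [← coeSubmodule_comap hW] at h1
  obtain ⟨g, hg, hgH⟩ := s.one_mem_finiteType_coeSubmodule.1 h1
  refine ⟨g, hg, Ideal.mem_map_C_iff.2 fun n => ?_⟩
  rw [coeff_C_mul, ← algebraMap_mem_coeSubmodule_iff (K := K)]
  apply hFI
  have h2 : G * (F * (1 / G)) ≤ F := by
    calc G * (F * (1 / G)) = F * (G * (1 / G)) := mul_left_comm _ _ _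
      _ ≤ F * 1 := mul_le_mul' le_rfl Submodule.mul_one_div_le_one
      _ = F := mul_one F
  rw [map_mul]
  exact h2 (Submodule.mul_mem_mul hxG (Ideal.mem_map_C_iff.1 hgH n))

/-- No P⋆MD hypothesis is needed in this direction: `c(g) ⊆ (I : x)`, and multiplying `1 ∈
c(g)^{⋆_f}` by `x` gives the claim. -/
theorem mem_finiteType_of_C_mul_mem {I : Ideal D} {x : D} {g : D[X]} (hg : g ∈ s.nagataSubmonoid)
    (h : C x * g ∈ I.map (C : D →+* D[X])) :
    algebraMap D K x ∈ s.finiteType.star (coeSubmodule K I) := by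
  by_cases hx : x = 0
  · simp [hx]
  have hx' : algebraMap D K x ≠ 0 := by simpa using hx
  have h1 : (1 : K) ∈ s.finiteType.star (coeSubmodule K g.contentIdeal) :=
    s.mem_finiteType_coeSubmodule.2
      ⟨_, g.contentIdeal_FG, le_rfl, s.mem_nagataSubmonoid.1 hg⟩
  refine s.finiteType.star_mono _ _ ?_ ((s.finiteType.mem_star_smul_iff hx').2 h1)
  rw [smul_le_iff]
  rintro _ ⟨y, hy, rfl⟩
  have hle : g.contentIdeal ≤ I.colon {x} := by
    rw [contentIdeal_le_iff_mem_map_C, Ideal.mem_map_C_iff]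
    intro n
    rw [Submodule.mem_colon_singleton, smul_eq_mul, mul_comm]
    simpa using Ideal.mem_map_C_iff.1 h n
  refine ⟨x * y, ?_, by simp⟩
  have := Submodule.mem_colon_singleton.1 (hle hy)
  rwa [smul_eq_mul, mul_comm] at this

variable [IsDomain D]

/-- The P⋆MD property in terms of integral ideals: the role of `F⁻¹` is played by `(a) : F`. -/
theorem isPStarMD_iff : s.IsPStarMD ↔ ∀ F : Ideal D, F.FG → ∀ a ∈ F, a ≠ 0 →
    algebraMap D K a ∈
      s.finiteType.star (coeSubmodule K (F * (Ideal.span {a}).colon (F : Set D))) := by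
  constructor
  · intro hs F hF a ha ha0
    have ha' : algebraMap D K a ≠ 0 := by simpa using ha0
    have h1 := (s.finiteType.star_eq_star_one_iff Submodule.mul_one_div_le_one).1
      (hs (coeSubmodule K F) (fun h => ha' (by
        simpa [h] using algebraMap_mem_coeSubmodule (K := K) F ha)) (Submodule.FG.map _ hF))
    -- For `a ∈ F`, `a F⁻¹` consists of elements of `(a) : F`, so `a F F⁻¹ ⊆ F ((a) : F)`.
    refine s.finiteType.star_mono _ _ ?_ ((s.finiteType.mem_star_smul_iff ha').2 h1)
    rw [smul_le_iff, coeSubmodule_mul]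
    intro z hz
    induction hz using Submodule.mul_induction_on' with
    | mem_mul_mem m hm u hu =>
      rw [mul_left_comm]
      refine Submodule.mul_mem_mul hm ?_
      rw [Submodule.mem_div_iff_forall_mul_mem] at hu
      obtain ⟨b, hb⟩ := Submodule.mem_one.1 (hu _ (algebraMap_mem_coeSubmodule F ha))
      refine ⟨b, Submodule.mem_colon.2 fun x hx => ?_, by rw [mul_comm]; exact hb⟩
      obtain ⟨c, hc⟩ := Submodule.mem_one.1 (hu _ (algebraMap_mem_coeSubmodule F hx))
      rw [smul_eq_mul, Ideal.mem_span_singleton']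
      refine ⟨c, IsFractionRing.injective D K ?_⟩
      rw [map_mul, map_mul, hc, hb]
      ring
    | add x _ y _ hx hy => rw [mul_add]; exact Submodule.add_mem _ hx hy
  · intro h F hF0 hF
    rw [s.finiteType.star_eq_star_one_iff Submodule.mul_one_div_le_one]
    -- Reduction to the integral ideal `I = d F`: if `b ∈ (a) : I`, then `d b / a ∈ F⁻¹`.
    obtain ⟨d, hd, hdF⟩ := FractionalIdeal.isFractional_of_fg (S := D⁰) hF
    have hd' : algebraMap D K d ≠ 0 := by simpa using nonZeroDivisors.ne_zero hd
    have hle : algebraMap D K d • F ≤ 1 := by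
      rw [smul_le_iff]
      intro y hy
      obtain ⟨c, hc⟩ := hdF y hy
      exact Submodule.mem_one.2 ⟨c, by rw [hc, Algebra.smul_def]⟩
    have hI := coeSubmodule_comap hle
    set I : Ideal D := (algebraMap D K d • F).comap (Algebra.linearMap D K)
    have hIfg : I.FG := by
      refine (coeSubmodule_fg K (IsFractionRing.injective D K) _).1 ?_
      rw [hI]
      exact hF.map _
    obtain ⟨y, hy, hy0⟩ := Submodule.exists_mem_ne_zero_of_ne_bot hF0
    have hya : algebraMap D K d * y ∈ coeSubmodule K I := by rw [hI]; exact mul_mem_smul hy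
    obtain ⟨a, ha, hay⟩ := hya
    have hay : algebraMap D K a = algebraMap D K d * y := hay
    have ha' : algebraMap D K a ≠ 0 := by rw [hay]; exact mul_ne_zero hd' hy0
    rw [← s.finiteType.mem_star_smul_iff ha']
    refine s.finiteType.star_mono _ _ ?_ (h I hIfg a ha (by simpa using ha'))
    rw [coeSubmodule_mul, Submodule.mul_le, hI]
    rintro m hm _ ⟨b, hb, rfl⟩
    obtain ⟨z, hz, rfl⟩ := (Submodule.mem_smul_pointwise_iff_exists _ _ _).1 hm
    have hu : algebraMap D K d * algebraMap D K b / algebraMap D K a ∈ 1 / F := by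
      rw [Submodule.mem_div_iff_forall_mul_mem]
      intro w hw
      have hwd : algebraMap D K d * w ∈ coeSubmodule K I := by rw [hI]; exact mul_mem_smul hw
      obtain ⟨e, he, hew⟩ := hwd
      have hew : algebraMap D K e = algebraMap D K d * w := hew
      have := Submodule.mem_colon.1 hb e he
      rw [smul_eq_mul, Ideal.mem_span_singleton'] at this
      obtain ⟨c, hc⟩ := this
      refine Submodule.mem_one.2 ⟨c, ?_⟩
      have hc' := congrArg (algebraMap D K) hc
      rw [map_mul, map_mul, hew] at hc'
      rw [div_mul_eq_mul_div, eq_div_iff ha', hc']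
      ring
    have := mul_mem_smul (x := algebraMap D K a) (Submodule.mul_mem_mul hz hu)
    convert this using 1
    simp only [smul_eq_mul, Algebra.linearMap_apply]
    field_simp

/-- In a P⋆MD, every element of `c(f)` is a multiple of `f` in the Nagata ring. -/
theorem IsPStarMD.exists_dvd_C_mul (hs : s.IsPStarMD) {f : D[X]} {c : D}
    (hc : c ∈ f.contentIdeal) : ∃ g ∈ s.nagataSubmonoid, f ∣ C c * g := by
  by_cases hf : f = 0
  · refine ⟨1, one_mem _, ?_⟩
    rw [hf, contentIdeal_zero, Ideal.mem_bot] at hc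
    simp [hc]
  obtain ⟨a, ha, ha0⟩ := Submodule.exists_mem_ne_zero_of_ne_bot
    (mt (contentIdeal_eq_bot_iff f).1 hf)
  have ha' : algebraMap D K a ≠ 0 := by simpa using ha0
  set A := (Ideal.span {a}).colon (f.contentIdeal : Set D)
  obtain ⟨G, hG, hGA, haG⟩ := s.mem_finiteType_coeSubmodule.1
    (s.isPStarMD_iff.1 hs _ f.contentIdeal_FG a ha ha0)
  -- `A` need not be finitely generated, but only finitely many of its elements are needed to cover
  -- `G`; a finitely generated `B` can be encoded by a polynomial `k`.
  obtain ⟨B, hB, hBA, hGB⟩ : ∃ B : Ideal D, B.FG ∧ B ≤ A ∧ G ≤ f.contentIdeal * B := by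
    clear haG
    induction G, hG using Submodule.fg_induction with
    | singleton x =>
      have hx : x ∈ f.contentIdeal * A := hGA (Submodule.mem_span_singleton_self x)
      clear hGA
      induction hx using Submodule.mul_induction_on' with
      | mem_mul_mem m hm n hn =>
        refine ⟨Ideal.span {n}, Submodule.fg_span_singleton n, ?_, ?_⟩
        · rwa [Ideal.span_singleton_le_iff_mem]
        · rw [Submodule.span_singleton_le_iff_mem]
          exact Ideal.mul_mem_mul hm (Ideal.mem_span_singleton_self n)
      | add x _ y _ hx hy =>
        obtain ⟨B, hB, hBA, hxB⟩ := hx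
        obtain ⟨B', hB', hBA', hxB'⟩ := hy
        refine ⟨B ⊔ B', Submodule.FG.sup hB hB', sup_le hBA hBA', ?_⟩
        rw [Submodule.span_singleton_le_iff_mem] at hxB hxB' ⊢
        exact Ideal.add_mem _ (Ideal.mul_mono_right le_sup_left hxB)
          (Ideal.mul_mono_right le_sup_right hxB')
    | sup G H _ _ ihG ihH =>
      obtain ⟨B, hB, hBA, hxB⟩ := ihG (le_sup_left.trans hGA)
      obtain ⟨B', hB', hBA', hxB'⟩ := ihH (le_sup_right.trans hGA)
      exact ⟨B ⊔ B', Submodule.FG.sup hB hB', sup_le hBA hBA', sup_le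
        (hxB.trans (Ideal.mul_mono_right le_sup_left))
        (hxB'.trans (Ideal.mul_mono_right le_sup_right))⟩
  obtain ⟨k, hkB, hfk⟩ := exists_contentIdeal_mul_eq f hB
  have hkA : ∀ n, ∀ x ∈ f.contentIdeal, a ∣ x * k.coeff n := fun n x hx => by
    rw [mul_comm, ← Ideal.mem_span_singleton]
    exact Submodule.mem_colon.1 (hBA (Ideal.mem_map_C_iff.1 hkB n)) x hx
  -- Since `k` has coefficients in `(a) : c(f)`, both `f k = a g` and `c k = a h` are solvable;
  -- cancelling `a` leaves `c g = f h`.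
  obtain ⟨g, hg⟩ : C a ∣ f * k := by
    rw [C_dvd_iff_dvd_coeff]
    intro n
    rw [coeff_mul]
    exact Finset.dvd_sum fun i _ => hkA _ _ (f.coeff_mem_contentIdeal _)
  obtain ⟨h, hh⟩ : C a ∣ C c * k := by
    rw [C_dvd_iff_dvd_coeff]
    intro n
    rw [coeff_C_mul]
    exact hkA _ _ hc
  refine ⟨g, ?_, h, ?_⟩
  -- `G ⊆ c(f) B = c(f k) = c(a g) ⊆ a c(g)`, so `a ∈ G^⋆` forces `1 ∈ c(g)^⋆`.
  · rw [s.mem_nagataSubmonoid, ← s.mem_star_smul_iff ha']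
    refine s.star_mono _ _ ?_ haG
    intro y hy
    obtain ⟨z, hz, rfl⟩ := coeSubmodule_mono K hGB hy
    have hz : z ∈ f.contentIdeal * B := hz
    rw [← hfk, hg] at hz
    have hz' := contentIdeal_mul_le_mul_contentIdeal _ _ hz
    rw [contentIdeal_C, Ideal.mem_span_singleton_mul] at hz'
    obtain ⟨w, hw, rfl⟩ := hz'
    rw [Algebra.linearMap_apply, map_mul]
    exact mul_mem_smul (algebraMap_mem_coeSubmodule _ hw)
  · refine mul_left_cancel₀ (C_ne_zero.2 ha0) ?_
    calc C a * (C c * g) = C c * (C a * g) := by ring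
      _ = f * (C c * k) := by rw [← hg]; ring
      _ = C a * (f * h) := by rw [hh]; ring

end SemistarOperation

/-! ### Invertible ideals and Bézout domains. -/

/-- If an invertible ideal `I` contains `x`, then `(x) = I J` for some ideal `J`. -/
theorem Ideal.exists_mul_eq_span_singleton_of_isUnit {R : Type*} [CommRing R] [IsDomain R]
    {I : Ideal R} (hI : IsUnit (I : FractionalIdeal R⁰ (FractionRing R))) {x : R} (hx : x ∈ I) :
    ∃ J : Ideal R, I * J = Ideal.span {x} := by
  obtain ⟨u, hu⟩ := hI
  have hle : (u⁻¹ : (FractionalIdeal R⁰ (FractionRing R))ˣ).val *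
      ((Ideal.span {x} : Ideal R) : FractionalIdeal R⁰ (FractionRing R)) ≤ 1 := by
    rw [← Units.inv_mul u, hu]
    refine mul_le_mul' le_rfl ((FractionalIdeal.coeIdeal_le_coeIdeal _).2 ?_)
    rwa [Ideal.span_singleton_le_iff_mem]
  obtain ⟨J, hJ⟩ := FractionalIdeal.le_one_iff_exists_coeIdeal.1 hle
  refine ⟨J, FractionalIdeal.coeIdeal_injective (K := FractionRing R) ?_⟩
  change ((I * J : Ideal R) : FractionalIdeal R⁰ (FractionRing R)) = _
  rw [FractionalIdeal.coeIdeal_mul, hJ, ← hu, Units.mul_inv_cancel_left]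

theorem IsPruferDomain.of_isBezout (R : Type*) [CommRing R] [IsDomain R] [IsBezout R] :
    IsPruferDomain R where
  isDomain := inferInstance
  isUnit_of_fg I hI hfg := by
    obtain ⟨x, rfl⟩ := (IsBezout.isPrincipal_of_FG I hfg).principal
    have hx : x ≠ 0 := by
      rintro rfl
      simp at hI
    exact IsUnit.of_mul_eq_one _
      (FractionalIdeal.coe_ideal_span_singleton_mul_inv (FractionRing R) hx)

/-! ### The Nagata ring is Prüfer exactly over a P⋆MD. -/

namespace SemistarOperation

open Polynomial IsLocalization

variable {D K : Type*} [CommRing D] [Field K] [Algebra D K] (s : SemistarOperation D K)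

/-- The canonical map from `D` to its semistar Nagata ring. -/
noncomputable def toNagata : D →+* s.Nagata := (algebraMap D[X] s.Nagata).comp C

theorem map_toNagata (I : Ideal D) :
    I.map s.toNagata = (I.map (C : D →+* D[X])).map (algebraMap D[X] s.Nagata) :=
  (Ideal.map_map _ _).symm

theorem algebraMap_mem_map_toNagata {I : Ideal D} {f : D[X]} :
    algebraMap D[X] s.Nagata f ∈ I.map s.toNagata ↔
      ∃ g ∈ s.nagataSubmonoid, g * f ∈ I.map (C : D →+* D[X]) := by
  rw [map_toNagata, algebraMap_mem_map_algebraMap_iff s.nagataSubmonoid]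

theorem toNagata_mem_map_toNagata {I : Ideal D} {x : D} :
    s.toNagata x ∈ I.map s.toNagata ↔
      ∃ g ∈ s.nagataSubmonoid, C x * g ∈ I.map (C : D →+* D[X]) := by
  simp_rw [mul_comm (C x)]
  exact s.algebraMap_mem_map_toNagata

theorem isDomain_nagata [IsDomain D] : IsDomain s.Nagata :=
  isDomain_localization s.nagataSubmonoid_le_nonZeroDivisors

theorem algebraMap_nagata_injective [IsDomain D] :
    Function.Injective (algebraMap D[X] s.Nagata) :=
  IsLocalization.injective _ s.nagataSubmonoid_le_nonZeroDivisors

theorem toNagata_injective [IsDomain D] : Function.Injective s.toNagata :=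
  s.algebraMap_nagata_injective.comp (C_injective (R := D))

theorem map_toNagata_ne_bot [IsDomain D] {P : Ideal D} (hP : P ≠ ⊥) : P.map s.toNagata ≠ ⊥ := by
  rwa [ne_eq, Ideal.map_eq_bot_iff_of_injective s.toNagata_injective]

theorem isUnit_algebraMap_nagata {g : D[X]} (hg : g ∈ s.nagataSubmonoid) :
    IsUnit (algebraMap D[X] s.Nagata g) :=
  map_units s.Nagata (⟨g, hg⟩ : s.nagataSubmonoid)

theorem exists_mul_eq_algebraMap_nagata (z : s.Nagata) : ∃ (f g : D[X]) (_ : g ∈ s.nagataSubmonoid),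
    z * algebraMap D[X] s.Nagata g = algebraMap D[X] s.Nagata f := by
  obtain ⟨⟨f, g⟩, h⟩ := IsLocalization.surj s.nagataSubmonoid z
  exact ⟨f, g, g.2, h⟩

variable [IsDomain D]

/-- If `h F ⊆ a Na(D,⋆)` for a finitely generated ideal `F` of `D`, then one element of `N(⋆)`
clears the denominators of all the quotients. -/
theorem exists_mul_mem_span_of_fg {F : Ideal D} (hF : F.FG) (a : D) (h : D[X])
    (hh : ∀ x ∈ F, s.toNagata a ∣ algebraMap D[X] s.Nagata h * s.toNagata x) :
    ∃ g ∈ s.nagataSubmonoid, ∀ x ∈ F, C a ∣ g * h * C x := by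
  induction F, hF using Submodule.fg_induction with
  | singleton x =>
    obtain ⟨z, hz⟩ := hh x (Submodule.mem_span_singleton_self x)
    obtain ⟨k, g, hg, hk⟩ := s.exists_mul_eq_algebraMap_nagata z
    refine ⟨g, hg, fun y hy => ?_⟩
    obtain ⟨b, rfl⟩ := Ideal.mem_span_singleton.1 hy
    rw [C_mul, ← mul_assoc]
    refine Dvd.dvd.mul_right ⟨k, s.algebraMap_nagata_injective ?_⟩ _
    rw [map_mul, map_mul, map_mul, ← hk]
    calc _ = algebraMap D[X] s.Nagata g * (algebraMap D[X] s.Nagata h * s.toNagata x) := by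
          rw [mul_assoc]; rfl
      _ = _ := by rw [hz]; exact by simp only [toNagata, RingHom.comp_apply]; ring
  | sup A B _ _ ihA ihB =>
    obtain ⟨g, hg, hA⟩ := ihA fun x hx => hh x (Ideal.mem_sup_left hx)
    obtain ⟨g', hg', hB⟩ := ihB fun x hx => hh x (Ideal.mem_sup_right hx)
    refine ⟨g * g', mul_mem hg hg', fun x hx => ?_⟩
    obtain ⟨y, hy, z, hz, rfl⟩ := Submodule.mem_sup.1 hx
    rw [C_add, mul_add]
    refine dvd_add ?_ ?_
    · convert (hA y hy).mul_left g' using 1; ring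
    · convert (hB z hz).mul_left g using 1; ring

variable [IsFractionRing D K]

/-- Over a P⋆MD, divisibility in the Nagata ring is governed by content ideals. -/
theorem IsPStarMD.algebraMap_dvd (hs : s.IsPStarMD) {f h : D[X]}
    (hfh : f.contentIdeal ≤ h.contentIdeal) :
    algebraMap D[X] s.Nagata h ∣ algebraMap D[X] s.Nagata f := by
  have hle : h.contentIdeal.map (C : D →+* D[X]) ≤
      (Ideal.span {algebraMap D[X] s.Nagata h}).comap (algebraMap D[X] s.Nagata) := by
    rw [Ideal.map_le_iff_le_comap]
    intro c hc
    obtain ⟨g, hg, hdvd⟩ := hs.exists_dvd_C_mul s hc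
    rw [Ideal.mem_comap, Ideal.mem_comap, Ideal.mem_span_singleton,
      ← (s.isUnit_algebraMap_nagata hg).dvd_mul_right, ← map_mul]
    exact map_dvd _ hdvd
  exact Ideal.mem_span_singleton.1 (hle (contentIdeal_le_iff_mem_map_C.1 hfh))

/-- Up to units two elements are polynomials `f`, `f'`; with a large shift, `f + X ^ N * f'` has
content `c(f) + c(f')`, hence divides both and generates their ideal. -/
theorem IsPStarMD.isBezout_nagata (hs : s.IsPStarMD) : IsBezout s.Nagata := by
  rw [IsBezout.iff_span_pair_isPrincipal]
  intro x y
  obtain ⟨f, g, hg, hx⟩ := s.exists_mul_eq_algebraMap_nagata x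
  obtain ⟨f', g', hg', hy⟩ := s.exists_mul_eq_algebraMap_nagata y
  have hc := contentIdeal_add_X_pow_mul f' (Nat.lt_succ_self f.natDegree)
  set h := f + X ^ (f.natDegree + 1) * f'
  refine ⟨⟨algebraMap D[X] s.Nagata h, le_antisymm ?_ ?_⟩⟩
  · rw [Ideal.span_le, Set.insert_subset_iff, Set.singleton_subset_iff]
    constructor <;> refine Ideal.mem_span_singleton.2 ?_
    · rw [← (s.isUnit_algebraMap_nagata hg).dvd_mul_right, hx]
      exact hs.algebraMap_dvd s (hc.symm ▸ le_sup_left)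
    · rw [← (s.isUnit_algebraMap_nagata hg').dvd_mul_right, hy]
      exact hs.algebraMap_dvd s (hc.symm ▸ le_sup_right)
  · rw [Submodule.span_singleton_le_iff_mem, map_add, map_mul, ← hx, ← hy]
    exact Ideal.add_mem _ (Ideal.mul_mem_right _ _ (Ideal.subset_span (by simp)))
      (Ideal.mul_mem_left _ _ (Ideal.mul_mem_right _ _ (Ideal.subset_span (by simp))))

theorem IsPStarMD.isPruferDomain_nagata (hs : s.IsPStarMD) : IsPruferDomain s.Nagata :=
  have := s.isDomain_nagata
  have := hs.isBezout_nagata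
  .of_isBezout _

theorem isPStarMD_of_isPruferDomain_nagata (hR : IsPruferDomain s.Nagata) : s.IsPStarMD := by
  have := s.isDomain_nagata
  rw [isPStarMD_iff]
  intro F hF a ha ha0
  have haF := Ideal.mem_map_of_mem s.toNagata ha
  have hF0 : F.map s.toNagata ≠ ⊥ :=
    s.map_toNagata_ne_bot fun h => ha0 (by rwa [h, Ideal.mem_bot] at ha)
  obtain ⟨J, hJ⟩ := Ideal.exists_mul_eq_span_singleton_of_isUnit
    (hR.isUnit_of_fg _ hF0 (hF.map _)) haF
  set A := (Ideal.span {a}).colon (F : Set D)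
  -- Each `j ∈ J` multiplies `F` into `(a)`. As `F` is finitely generated, one denominator serves
  -- all of `F`, and the coefficients of the cleared numerator of `j` then lie in `(a) : F`.
  have hJA : J ≤ A.map s.toNagata := by
    intro j hj
    obtain ⟨h, g, hg, hjh⟩ := s.exists_mul_eq_algebraMap_nagata j
    obtain ⟨g', hg', hd⟩ := s.exists_mul_mem_span_of_fg hF a h fun x hx => by
      rw [← hjh, mul_right_comm, ← Ideal.mem_span_singleton, ← hJ, mul_comm j]
      exact Ideal.mul_mem_right _ _ (Ideal.mul_mem_mul (Ideal.mem_map_of_mem _ hx) hj)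
    rw [← Ideal.mul_unit_mem_iff_mem _ (s.isUnit_algebraMap_nagata hg), hjh,
      algebraMap_mem_map_toNagata]
    refine ⟨g', hg', Ideal.mem_map_C_iff.2 fun n => Submodule.mem_colon.2 fun x hx => ?_⟩
    rw [smul_eq_mul, Ideal.mem_span_singleton, ← coeff_mul_C]
    exact (C_dvd_iff_dvd_coeff _ _).1 (hd x hx) n
  have ha' : s.toNagata a ∈ (F * A).map s.toNagata := by
    rw [Ideal.map_mul]
    refine Ideal.mul_mono_right hJA ?_
    rw [hJ]
    exact Ideal.mem_span_singleton_self _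
  obtain ⟨g, hg, h⟩ := s.toNagata_mem_map_toNagata.1 ha'
  exact s.mem_finiteType_of_C_mul_mem hg h

end SemistarOperation

/-! ### Transfer of primes, branchedness and idempotence. -/

namespace SemistarOperation

open Polynomial IsLocalization

variable {D K : Type*} [CommRing D] [Field K] [Algebra D K] (s : SemistarOperation D K)

theorem isPrime_map_toNagata {P : Ideal D} [hP : P.IsPrime]
    (h : P.map s.toNagata ≠ ⊤) : (P.map s.toNagata).IsPrime := by
  rw [map_toNagata] at h ⊢
  exact isPrime_of_isPrime_disjoint s.nagataSubmonoid s.Nagata _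
    Ideal.isPrime_map_C_of_isPrime
    ((map_algebraMap_ne_top_iff_disjoint s.nagataSubmonoid s.Nagata _).1 h)

/-- After clearing denominators, the numerator of `m` has a coefficient outside `P` whose product
with `x` lies in `J`, and `J` is `P`-primary. -/
theorem mem_of_mul_mem_map_toNagata {J P : Ideal D} (hJ : J.IsPrimary) (hJP : J.radical = P)
    {x : D} {m : s.Nagata} (hm : m ∉ P.map s.toNagata)
    (h : m * s.toNagata x ∈ J.map s.toNagata) : x ∈ J := by
  obtain ⟨f, g, hg, hf⟩ := s.exists_mul_eq_algebraMap_nagata m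
  rw [← Ideal.unit_mul_mem_iff_mem _ (s.isUnit_algebraMap_nagata hg), ← mul_assoc,
    mul_comm _ m, hf, toNagata, RingHom.comp_apply, ← map_mul, ← toNagata,
    algebraMap_mem_map_toNagata] at h
  obtain ⟨g', hg', h⟩ := h
  rw [← Ideal.mul_unit_mem_iff_mem _ (s.isUnit_algebraMap_nagata hg), hf,
    algebraMap_mem_map_toNagata] at hm
  have hgf : g' * f ∉ P.map (C : D →+* D[X]) := fun h' => hm ⟨g', hg', h'⟩
  rw [Ideal.mem_map_C_iff, not_forall] at hgf
  obtain ⟨n, hn⟩ := hgf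
  have hn' := Ideal.mem_map_C_iff.1 h n
  rw [← mul_assoc, coeff_mul_C, mul_comm] at hn'
  exact ((Ideal.isPrimary_iff.1 hJ).2 hn').resolve_right (hJP ▸ hn)

theorem comap_map_toNagata {P : Ideal D} [hP : P.IsPrime]
    (h : P.map s.toNagata ≠ ⊤) : (P.map s.toNagata).comap s.toNagata = P := by
  refine le_antisymm (fun x hx => ?_) Ideal.le_comap_map
  refine s.mem_of_mul_mem_map_toNagata hP.isPrimary hP.radical
    (m := 1) ((Ideal.ne_top_iff_one _).1 h) ?_
  rwa [one_mul]

/-- Rather than proving the extension of `J` primary, one localizes at the extended prime, where its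
radical becomes maximal, and contracts back. Were the result all of the extended prime,
`mem_of_mul_mem_map_toNagata` would force `P ⊆ J`. -/
theorem isBranched_map_toNagata {P : Ideal D} (h : P.map s.toNagata ≠ ⊤)
    (hP : IsBranched P) : IsBranched (P.map s.toNagata) := by
  obtain ⟨J, hJ, hJP, hne⟩ := hP
  have hPp : P.IsPrime := hJP ▸ Ideal.isPrime_radical hJ
  have := s.isPrime_map_toNagata h
  set 𝔓 := P.map s.toNagata with h𝔓
  let L := Localization.AtPrime 𝔓
  have hmax : (Ideal.map (algebraMap s.Nagata L) 𝔓) = IsLocalRing.maximalIdeal L :=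
    Localization.AtPrime.map_eq_maximalIdeal
  set I := (J.map s.toNagata).map (algebraMap s.Nagata L) with hI
  have hrad : I.radical = IsLocalRing.maximalIdeal L := by
    refine le_antisymm ?_ ?_
    · rw [← (IsLocalRing.maximalIdeal.isMaximal L).isPrime.radical, ← hmax]
      exact Ideal.radical_mono (Ideal.map_mono (Ideal.map_mono (hJP ▸ Ideal.le_radical)))
    · have hle : 𝔓 ≤ (J.map s.toNagata).radical := by
        rw [h𝔓, ← hJP]
        exact Ideal.map_radical_le _
      rw [← hmax]
      exact (Ideal.map_mono hle).trans (Ideal.map_radical_le _)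
  refine ⟨I.comap (algebraMap s.Nagata L), Ideal.IsPrimary.comap
    (Ideal.isPrimary_of_isMaximal_radical (hrad ▸ IsLocalRing.maximalIdeal.isMaximal L)) _, ?_, ?_⟩
  · rw [← Ideal.comap_radical, hrad]
    exact AtPrime.under_maximalIdeal L 𝔓
  · intro heq
    refine hne (le_antisymm (hJP ▸ Ideal.le_radical) fun x hx => ?_)
    have hx' : s.toNagata x ∈ I.comap (algebraMap s.Nagata L) := by
      rw [heq]
      exact Ideal.mem_map_of_mem _ hx
    rw [Ideal.mem_comap, hI, algebraMap_mem_map_algebraMap_iff 𝔓.primeCompl] at hx'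
    obtain ⟨m, hm, hmx⟩ := hx'
    exact s.mem_of_mul_mem_map_toNagata hJ hJP hm hmx

variable [IsFractionRing D K]

theorem one_mem_finiteType_iff_map_eq_top {I : Ideal D} :
    (1 : K) ∈ s.finiteType.star (coeSubmodule K I) ↔ I.map s.toNagata = ⊤ := by
  rw [one_mem_finiteType_coeSubmodule, Ideal.eq_top_iff_one, ← map_one s.toNagata,
    toNagata_mem_map_toNagata]
  simp

theorem IsQuasiStarPrime.map_ne_top {P : Ideal D} (hP : s.finiteType.IsQuasiStarPrime P) :
    P.map s.toNagata ≠ ⊤ := by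
  rw [ne_eq, ← one_mem_finiteType_iff_map_eq_top]
  intro h
  refine hP.2.ne_top ((Ideal.eq_top_iff_one _).2 ?_)
  rw [hP.1.2, Submodule.mem_comap]
  simpa using h

/-- In a P⋆MD, the trace on `D` of `I^{⋆_f}` is the contraction of the extension of `I` to the
Nagata ring. -/
theorem IsPStarMD.mem_finiteType_iff (hs : s.IsPStarMD) {I : Ideal D} {x : D} :
    algebraMap D K x ∈ s.finiteType.star (coeSubmodule K I) ↔
      s.toNagata x ∈ I.map s.toNagata := by
  rw [toNagata_mem_map_toNagata]
  exact ⟨hs.exists_C_mul_mem s, fun ⟨g, hg, h⟩ => s.mem_finiteType_of_C_mul_mem hg h⟩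

theorem IsPStarMD.isQuasiStarPrime (hs : s.IsPStarMD) {P : Ideal D} [hP : P.IsPrime]
    (hP0 : P ≠ ⊥) (h : P.map s.toNagata ≠ ⊤) : s.finiteType.IsQuasiStarPrime P := by
  refine ⟨⟨hP0, ?_⟩, hP⟩
  ext x
  rw [Submodule.mem_comap, Algebra.linearMap_apply, hs.mem_finiteType_iff, ← Ideal.mem_comap,
    s.comap_map_toNagata h]

/-- Both conditions reduce to `P` lying in a closure or extension of `P²`; this is tested on
elements of `D`, where closure and extension agree. -/
theorem IsPStarMD.isStarIdempotent_iff (hs : s.IsPStarMD) {P : Ideal D} :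
    s.finiteType.IsStarIdempotent (coeSubmodule K P) ↔ IsIdempotentElem (P.map s.toNagata) := by
  have h1 : IsIdempotentElem (P.map s.toNagata) ↔ P.map s.toNagata ≤ (P * P).map s.toNagata := by
    rw [Ideal.map_mul]
    exact ⟨fun h => h.ge, fun h => le_antisymm Ideal.mul_le_left h⟩
  rw [IsStarIdempotent, pow_two, ← coeSubmodule_mul, h1, Ideal.map_le_iff_le_comap]
  constructor
  · intro h x hx
    rw [Ideal.mem_comap, ← hs.mem_finiteType_iff, ← h]
    exact s.finiteType.le_star _ (algebraMap_mem_coeSubmodule _ hx)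
  · intro h
    refine le_antisymm (s.finiteType.star_le_iff.2 ?_)
      (s.finiteType.star_mono _ _ (coeSubmodule_mono K Ideal.mul_le_left))
    rintro _ ⟨x, hx, rfl⟩
    exact (hs.mem_finiteType_iff s).2 (h hx)

variable [IsDomain D]

/-- If a polynomial `f` lies in `I`, so does each of its coefficients `c`, because `c(f)` contains
`c` and hence `f` divides `c` in the Nagata ring. -/
theorem IsPStarMD.map_comap_toNagata (hs : s.IsPStarMD) (I : Ideal s.Nagata) :
    (I.comap s.toNagata).map s.toNagata = I := by
  refine le_antisymm Ideal.map_comap_le fun z hz => ?_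
  obtain ⟨f, g, hg, h⟩ := s.exists_mul_eq_algebraMap_nagata z
  rw [← Ideal.mul_unit_mem_iff_mem _ (s.isUnit_algebraMap_nagata hg), h, map_toNagata]
  have hf : algebraMap D[X] s.Nagata f ∈ I := h ▸ Ideal.mul_mem_right _ _ hz
  refine Ideal.mem_map_of_mem _ (contentIdeal_le_iff_mem_map_C.1 fun c hc => ?_)
  refine Ideal.mem_of_dvd I (hs.algebraMap_dvd s ?_) hf
  exact (contentIdeal_C c).trans_le ((Ideal.span_singleton_le_iff_mem _).2 hc)

theorem IsPStarMD.isBranched_comap_toNagata (hs : s.IsPStarMD) {Q : Ideal s.Nagata}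
    (hQ : IsBranched Q) : IsBranched (Q.comap s.toNagata) := by
  obtain ⟨J, hJ, hJQ, hne⟩ := hQ
  refine ⟨J.comap s.toNagata, hJ.comap _, by rw [← Ideal.comap_radical, hJQ], fun h => hne ?_⟩
  -- Contraction is injective on ideals, so distinct ideals stay distinct.
  rw [← hs.map_comap_toNagata s J, h, hs.map_comap_toNagata]

theorem IsPStarMD.isQuasiStarPrime_comap_toNagata (hs : s.IsPStarMD) {Q : Ideal s.Nagata}
    (hQ0 : Q ≠ ⊥) (hQ : Q.IsPrime) : s.finiteType.IsQuasiStarPrime (Q.comap s.toNagata) := by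
  refine hs.isQuasiStarPrime s (fun h => hQ0 ?_) ?_
  · rw [← hs.map_comap_toNagata s Q, h, Ideal.map_bot]
  · rw [hs.map_comap_toNagata]
    exact hQ.ne_top

theorem isDiscretePStarMD_iff : s.IsDiscretePStarMD ↔ IsDiscretePruferDomain s.Nagata := by
  constructor
  · rintro ⟨hs, h⟩
    refine ⟨hs.isPruferDomain_nagata, fun Q hQ0 hQ hQb hQi => ?_⟩
    refine h _ (hs.isQuasiStarPrime_comap_toNagata s hQ0 hQ) (hs.isBranched_comap_toNagata s hQb) ?_
    rwa [hs.isStarIdempotent_iff, hs.map_comap_toNagata]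
  · rintro ⟨hR, h⟩
    have hs := s.isPStarMD_of_isPruferDomain_nagata hR
    refine ⟨hs, fun P hP hPb hPi => ?_⟩
    have := hP.2
    exact h _ (s.map_toNagata_ne_bot hP.1.1) (s.isPrime_map_toNagata (hP.map_ne_top s))
      (s.isBranched_map_toNagata (hP.map_ne_top s) hPb) ((hs.isStarIdempotent_iff s).1 hPi)

theorem isStronglyDiscretePStarMD_iff :
    s.IsStronglyDiscretePStarMD ↔ IsStronglyDiscretePruferDomain s.Nagata := by
  constructor
  · rintro ⟨hs, h⟩
    refine ⟨hs.isPruferDomain_nagata, fun Q hQ0 hQ hQi => ?_⟩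
    refine h _ (hs.isQuasiStarPrime_comap_toNagata s hQ0 hQ) ?_
    rwa [hs.isStarIdempotent_iff, hs.map_comap_toNagata]
  · rintro ⟨hR, h⟩
    have hs := s.isPStarMD_of_isPruferDomain_nagata hR
    refine ⟨hs, fun P hP hPi => ?_⟩
    have := hP.2
    exact h _ (s.map_toNagata_ne_bot hP.1.1) (s.isPrime_map_toNagata (hP.map_ne_top s))
      ((hs.isStarIdempotent_iff s).1 hPi)

end SemistarOperation

theorem mainTheorem12 {D K : Type*} [CommRing D] [IsDomain D] [Field K] [Algebra D K]
    [IsFractionRing D K] (s : SemistarOperation D K) :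
    (s.IsDiscretePStarMD ↔ IsDiscretePruferDomain s.Nagata) ∧
      (s.IsStronglyDiscretePStarMD ↔ IsStronglyDiscretePruferDomain s.Nagata) :=
  ⟨s.isDiscretePStarMD_iff, s.isStronglyDiscretePStarMD_iff⟩
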